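/- Consider a planar rigid object, with three velocity coordinates, in contact at $n_c$ points with a manipulator having $n_m$ velocity coordinates. Let $J_{n,o}\in\mathbb R^{n_c\times 3}$, $J_{t,o}\in\mathbb R^{2n_c\times 3}$ and $J_{n,m}\in\mathbb R^{n_c\times n_m}$, $J_{t,m}\in\mathbb R^{2n_c\times n_m}$ be the normal and tangential contact Jacobians of the object and of the manipulator (two tangential rows per contact), and put $J_o=\begin{bmatrix}J_{n,o}\\J_{t,o}\end{bmatrix}$, $J_m=\begin{bmatrix}J_{n,m}\\J_{t,m}\end{bmatrix}$. Let $\mu\in\mathbb R^{n_c\times n_c}$ be the diagonal matrix of the nonnegative friction coefficients, let $E\in\mathbb R^{2n_c\times n_c}$ be the block-diagonal matrix with $n_c$ diagonal blocks $\begin{bmatrix}1\\1\end{bmatrix}$, and let $A=G\tilde A G^T$, where $\tilde A\in\mathbb R^{3\times 3}$ is symmetric positive definite (the ellipsoidal force-motion map of the surface contact in the body frame) and $G\in\mathbb R^{3\times 3}$ is the full-rank transformation from body-axis to world velocities. For $c\in\mathbb R$, $B\in\mathbb R^{n_m\times n_m}$ and $v_d\in\mathbb R^{n_m}$ define $$M(cB)=\begin{bmatrix}J_oAJ_o^T+J_m(cB)J_m^T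 & \begin{bmatrix}0\\E\end{bmatrix}\\ \begin{bmatrix}\mu & -E^T\end{bmatrix} & 0\end{bmatrix},\qquad q(v_d)=\begin{bmatrix}J_mv_d\\0\end{bmatrix}.$$ Then for every feedback scaling $c>0$, every positive definite relative gain matrix $B$ (that is, $x^TBx>0$ for all $x\neq0$; symmetry is not needed), and every commanded manipulator velocity $v_d$, the linear complementarity problem $\mathrm{LCP}(M(cB),q(v_d))$ has a solution: there is $z\in\mathbb R^{4n_c}$ with $$z\ge 0,\qquad M(cB)z+q(v_d)\ge 0,\qquad z^T\bigl(M(cB)z+q(v_d)\bigr)=0,$$ where the inequalities hold entrywise. -/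

import Mathlib

open Matrix

/-- The solution set of the linear complementarity problem `LCP(M, q)`:
`zᵀ (M z + q) = 0`, `z ≥ 0`, `M z + q ≥ 0`, inequalities being entrywise. -/
def lcpSol {ι : Type*} [Fintype ι] (M : Matrix ι ι ℝ) (q : ι → ℝ) : Set (ι → ℝ) :=
  {z | z ⬝ᵥ (M *ᵥ z + q) = 0 ∧ 0 ≤ z ∧ 0 ≤ M *ᵥ z + q}

/-- Index set of the contact forces `f = [fₙ; fₜ]` at `nc` contacts: one normal force per contact,
and two nonnegative opposing tangential forces per contact. -/
abbrev ForceIdx (nc : ℕ) : Type := Fin nc ⊕ (Fin nc × Fin 2)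

/-- Index set of the complementarity variable `z = [fₙ; fₜ; s]`, with one sliding slack variable
per contact. -/
abbrev LcpIdx (nc : ℕ) : Type := ForceIdx nc ⊕ Fin nc

/-- The block-diagonal matrix `E` with `nc` diagonal blocks `[1; 1]`. -/
def contactE (nc : ℕ) : Matrix (Fin nc × Fin 2) (Fin nc) ℝ :=
  Matrix.of fun p j => if p.1 = j then 1 else 0

/-- The grouped contact Jacobian `J = [Jₙ; Jₜ]` of a body with `d` generalized velocities. -/
def contactJacobian {nc d : ℕ} (Jn : Matrix (Fin nc) (Fin d) ℝ)
    (Jt : Matrix (Fin nc × Fin 2) (Fin d) ℝ) : Matrix (ForceIdx nc) (Fin d) ℝ :=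
  Matrix.fromRows Jn Jt

/-- The force-motion matrix `A = G Ã Gᵀ` in the world frame, where `fᵀ Ã f` is the ellipsoidal
force-motion form in the body frame and `G` maps body-axis velocities to world velocities. -/
def forceMotionMatrix (G Atilde : Matrix (Fin 3) (Fin 3) ℝ) : Matrix (Fin 3) (Fin 3) ℝ :=
  G * Atilde * Gᵀ

/-- The matrix of the quasi-static LCP with manipulator feedback matrix `K` (`K = c B`):
`M(K) = [Jₒ A Jₒᵀ + Jₘ K Jₘᵀ, [0; E]; [μ, -Eᵀ], 0]`. -/
def feedbackLcpMatrix {nc nm : ℕ} (A : Matrix (Fin 3) (Fin 3) ℝ)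
    (Jo : Matrix (ForceIdx nc) (Fin 3) ℝ) (Jm : Matrix (ForceIdx nc) (Fin nm) ℝ)
    (μ : Fin nc → ℝ) (K : Matrix (Fin nm) (Fin nm) ℝ) : Matrix (LcpIdx nc) (LcpIdx nc) ℝ :=
  Matrix.fromBlocks
    (Jo * A * Joᵀ + Jm * K * Jmᵀ) (Matrix.fromRows 0 (contactE nc))
    (Matrix.fromCols (Matrix.diagonal μ) (-(contactE nc)ᵀ)) 0

/-- The vector of the quasi-static LCP for the commanded manipulator velocity `v`:
`q(v) = [Jₘ v; 0]`. -/
def feedbackLcpVector {nc nm : ℕ} (Jm : Matrix (ForceIdx nc) (Fin nm) ℝ) (v : Fin nm → ℝ) :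
    LcpIdx nc → ℝ :=
  Sum.elim (Jm *ᵥ v) 0

/-! For z = [f; s] ≥ 0 the blocks E and -Eᵀ cancel in zᵀMz, leaving the object form, sᵀμfₙ and the
form of cB at u = Jₘᵀf, all nonnegative. So M is copositive; and since qᵀz = v_dᵀu, positive
definiteness of cB gives (qᵀz)² ≤ C zᵀMz.

These two facts suffice (`lcpSol_nonempty_of_copositive`). The matrix M + εI is strictly copositive,
so a parity version of Lemke's method (`lcpSol_nonempty_of_isGenericFor`) solves its LCP at a
generic q' near q. A solution z also solves LCP(M, q' + εz), and the bound on qᵀz forces εz → 0 with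
ε. Hence q is a limit of solvable vectors, and these form a finite union of closed cones
(`isClosed_setOf_lcpSol_nonempty`). -/

/-! ### Closedness of finitely generated cones. -/

section Orthant

variable {σ F : Type*} [Fintype σ] [AddCommGroup F] [Module ℝ F]

/-- A point of a face of the orthant on which `L` is not injective can be moved, within its fibre,
to a smaller face. -/
theorem exists_orthant_erase_of_mem_ker [DecidableEq σ] (L : (σ → ℝ) →ₗ[ℝ] F) (s : Finset σ)
    (k : σ → ℝ) (hk : ∀ i ∉ s, k i = 0) (hLk : L k = 0) (hpos : ∃ i, 0 < k i)
    (x : σ → ℝ) (hx : 0 ≤ x) (hxs : ∀ i ∉ s, x i = 0) :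
    ∃ j ∈ s, ∃ y : σ → ℝ, 0 ≤ y ∧ (∀ i ∉ s.erase j, y i = 0) ∧ L y = L x := by
  obtain ⟨i₀, hi₀⟩ := hpos
  -- Ratio test: the minimal x i / k i is the longest step along -k that stays in the orthant.
  obtain ⟨j, hj, hmin⟩ := Finset.exists_min_image (Finset.univ.filter fun i => 0 < k i)
    (fun i => x i / k i) ⟨i₀, by simpa using hi₀⟩
  have hkj : 0 < k j := by simpa using hj
  have hjs : j ∈ s := by
    by_contra h
    exact hkj.ne' (hk j h)
  refine ⟨j, hjs, x - (x j / k j) • k, fun i => ?_, fun i hi => ?_, by simp [hLk]⟩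
  · have ht : 0 ≤ x j / k j := div_nonneg (hx j) hkj.le
    simp only [Pi.zero_apply, Pi.sub_apply, Pi.smul_apply, smul_eq_mul, sub_nonneg]
    rcases lt_or_ge 0 (k i) with hki | hki
    · have := hmin i (by simpa using hki)
      exact (le_div_iff₀ hki).1 this
    · exact (mul_nonpos_of_nonneg_of_nonpos ht hki).trans (hx i)
  · by_cases hij : i = j
    · subst hij
      simp [div_mul_cancel₀ _ hkj.ne']
    · have his : i ∉ s := fun h => hi (Finset.mem_erase.2 ⟨hij, h⟩)
      simp [hxs i his, hk i his]

/-- If `L` is injective on the span of the face, it is a closed embedding there. Otherwise, as in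
Carathéodory's theorem, the image is the union of the images of smaller faces, closed by induction.
-/
theorem isClosed_image_orthant_face [TopologicalSpace F] [IsTopologicalAddGroup F]
    [ContinuousSMul ℝ F] [T2Space F] (L : (σ → ℝ) →ₗ[ℝ] F) (s : Finset σ) :
    IsClosed (L '' {x | 0 ≤ x ∧ ∀ i ∉ s, x i = 0}) := by
  classical
  induction s using Finset.strongInduction with
  | H s ih =>
    by_cases hinj : ∀ k : σ → ℝ, (∀ i ∉ s, k i = 0) → L k = 0 → k = 0
    · let V : Submodule ℝ (σ → ℝ) :=
        { carrier := {x | ∀ i ∉ s, x i = 0}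
          add_mem' := fun ha hb i hi => by simp [ha i hi, hb i hi]
          zero_mem' := fun i _ => rfl
          smul_mem' := fun c x hx i hi => by simp [hx i hi] }
      have hker : LinearMap.ker (L ∘ₗ V.subtype) = ⊥ := by
        rw [LinearMap.ker_eq_bot']
        rintro ⟨k, hk⟩ hLk
        exact Subtype.ext (hinj k hk hLk)
      have hemb := LinearMap.isClosedEmbedding_of_injective hker
      have hcl : IsClosed {v : V | (0 : σ → ℝ) ≤ v} :=
        isClosed_le continuous_const continuous_subtype_val
      convert hemb.isClosedMap _ hcl using 1
      ext q
      constructor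
      · rintro ⟨x, ⟨hx, hxs⟩, rfl⟩
        exact ⟨⟨x, hxs⟩, hx, rfl⟩
      · rintro ⟨⟨x, hxs⟩, hx, rfl⟩
        exact ⟨x, ⟨hx, hxs⟩, rfl⟩
    · push Not at hinj
      obtain ⟨k, hk, hLk, hk0⟩ := hinj
      obtain ⟨k, hk, hLk, hpos⟩ : ∃ k : σ → ℝ, (∀ i ∉ s, k i = 0) ∧ L k = 0 ∧ ∃ i, 0 < k i := by
        obtain ⟨i, hi⟩ := Function.ne_iff.1 hk0
        rcases lt_or_gt_of_ne hi with h | h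
        · exact ⟨-k, fun i hi => by simp [hk i hi], by simp [hLk], i, by simpa using h⟩
        · exact ⟨k, hk, hLk, i, h⟩
      have hunion : L '' {x | 0 ≤ x ∧ ∀ i ∉ s, x i = 0} =
          ⋃ j ∈ s, L '' {x | 0 ≤ x ∧ ∀ i ∉ s.erase j, x i = 0} := by
        ext q
        simp only [Set.mem_iUnion]
        constructor
        · rintro ⟨x, ⟨hx, hxs⟩, rfl⟩
          obtain ⟨j, hj, y, hy, hys, hLy⟩ :=
            exists_orthant_erase_of_mem_ker L s k hk hLk hpos x hx hxs
          exact ⟨j, hj, y, ⟨hy, hys⟩, hLy⟩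
        · rintro ⟨j, hj, x, ⟨hx, hxs⟩, rfl⟩
          exact ⟨x, ⟨hx, fun i hi => hxs i fun h => hi (Finset.mem_of_mem_erase h)⟩, rfl⟩
      rw [hunion]
      exact s.finite_toSet.isClosed_biUnion fun j hj => ih _ (Finset.erase_ssubset hj)

/-- A finitely generated cone is closed. -/
theorem isClosed_image_orthant [TopologicalSpace F] [IsTopologicalAddGroup F]
    [ContinuousSMul ℝ F] [T2Space F] (L : (σ → ℝ) →ₗ[ℝ] F) :
    IsClosed (L '' {x | 0 ≤ x}) := by
  simpa using isClosed_image_orthant_face L Finset.univ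

end Orthant

/-! ### Solvability of an LCP as membership in a complementary cone. -/

section ComplementaryCone

variable {ι : Type*} [Fintype ι] [DecidableEq ι]

/-- The linear map whose columns are `-M eᵢ` for `i ∈ α` and `eᵢ` for `i ∉ α`; the image of the
orthant is the complementary cone of `M` indexed by `α`. -/
def complMap (M : Matrix ι ι ℝ) (α : Finset ι) : (ι → ℝ) →ₗ[ℝ] (ι → ℝ) where
  toFun x := (fun i => if i ∈ α then 0 else x i) - M *ᵥ fun i => if i ∈ α then x i else 0
  map_add' x y := by
    have h1 : (fun i => if i ∈ α then (x + y) i else 0) =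
        (fun i => if i ∈ α then x i else 0) + fun i => if i ∈ α then y i else 0 := by
      ext i; by_cases h : i ∈ α <;> simp [h]
    rw [h1, Matrix.mulVec_add]
    ext i
    by_cases h : i ∈ α <;> simp [h] <;> ring
  map_smul' c x := by
    have h1 : (fun i => if i ∈ α then (c • x) i else 0) =
        c • (fun i => if i ∈ α then x i else 0) := by
      ext i; by_cases h : i ∈ α <;> simp [h]
    rw [h1, Matrix.mulVec_smul]
    ext i
    by_cases h : i ∈ α <;> simp [h]; ring

theorem complMap_apply (M : Matrix ι ι ℝ) (α : Finset ι) (x : ι → ℝ) :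
    complMap M α x =
      (fun i => if i ∈ α then 0 else x i) - M *ᵥ fun i => if i ∈ α then x i else 0 := rfl

/-- The coordinates of x in α form z, the others form w = Mz + q, so the supports are disjoint. -/
theorem restrict_mem_lcpSol {M : Matrix ι ι ℝ} {α : Finset ι} {x q : ι → ℝ} (hx : 0 ≤ x)
    (h : complMap M α x = q) : (fun i => if i ∈ α then x i else 0) ∈ lcpSol M q := by
  have hw : (M *ᵥ fun i => if i ∈ α then x i else 0) + q = fun i => if i ∈ α then 0 else x i := by
    rw [← h, complMap_apply]; abel
  refine ⟨?_, fun i => ?_, ?_⟩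
  · rw [hw]
    refine Finset.sum_eq_zero fun i _ => ?_
    by_cases hi : i ∈ α <;> simp [hi]
  · by_cases hi : i ∈ α
    · simpa [hi] using hx i
    · simp [hi]
  · rw [hw]
    intro i
    by_cases hi : i ∈ α
    · simp [hi]
    · simpa [hi] using hx i

theorem exists_complMap_eq_of_mem_lcpSol {M : Matrix ι ι ℝ} {q z : ι → ℝ} (hz : z ∈ lcpSol M q) :
    ∃ α : Finset ι, ∃ x : ι → ℝ, 0 ≤ x ∧ complMap M α x = q := by
  obtain ⟨h0, hz0, hw0⟩ := hz
  have hcompl : ∀ i, z i * (M *ᵥ z + q) i = 0 := fun i =>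
    (Finset.sum_eq_zero_iff_of_nonneg fun j _ => mul_nonneg (hz0 j) (hw0 j)).1 h0 i
      (Finset.mem_univ i)
  have hz' : ∀ i, ¬ 0 < z i → z i = 0 := fun i hi => le_antisymm (not_lt.1 hi) (hz0 i)
  have hw' : ∀ i, 0 < z i → (M *ᵥ z + q) i = 0 := fun i hi =>
    (mul_eq_zero.1 (hcompl i)).resolve_left hi.ne'
  refine ⟨Finset.univ.filter fun i => 0 < z i, z + (M *ᵥ z + q), add_nonneg hz0 hw0, ?_⟩
  have h1 : (fun i => if i ∈ Finset.univ.filter (fun i => 0 < z i) then (z + (M *ᵥ z + q)) i else 0)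
      = z := by
    ext i
    by_cases hi : 0 < z i
    · rw [if_pos (by simpa using hi), Pi.add_apply, hw' i hi, add_zero]
    · rw [if_neg (by simpa using hi), hz' i hi]
  have h2 : (fun i => if i ∈ Finset.univ.filter (fun i => 0 < z i) then 0 else (z + (M *ᵥ z + q)) i)
      = M *ᵥ z + q := by
    ext i
    by_cases hi : 0 < z i
    · rw [if_pos (by simpa using hi), hw' i hi]
    · rw [if_neg (by simpa using hi), Pi.add_apply, hz' i hi, zero_add]
  rw [complMap_apply, h1, h2]
  abel

/-- The vectors `q` for which `LCP(M, q)` is solvable form a closed set. -/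
theorem isClosed_setOf_lcpSol_nonempty (M : Matrix ι ι ℝ) :
    IsClosed {q | (lcpSol M q).Nonempty} := by
  have h : {q | (lcpSol M q).Nonempty} = ⋃ α : Finset ι, complMap M α '' {x | 0 ≤ x} := by
    ext q
    simp only [Set.mem_iUnion, Set.mem_image, Set.mem_ofPred_eq]
    constructor
    · rintro ⟨z, hz⟩
      exact exists_complMap_eq_of_mem_lcpSol hz
    · rintro ⟨α, x, hx, hq⟩
      exact ⟨_, restrict_mem_lcpSol hx hq⟩
  rw [h]
  exact isClosed_iUnion_of_finite fun α => isClosed_image_orthant _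

end ComplementaryCone

/-! ### End points of a generic line section of the orthant. -/

section Segment

variable {σ : Type*} [Fintype σ]

/-- On a line `y + s k` meeting the orthant and leaving it as `s → -∞`, exactly one coordinate with
`k o > 0` vanishes at a point of the orthant. -/
theorem existsUnique_active_of_pos {y k : σ → ℝ}
    (hgen : ∀ s : ℝ, 0 ≤ y + s • k → ∀ o o', (y + s • k) o = 0 → (y + s • k) o' = 0 → o = o')
    (hne : ∃ s : ℝ, 0 ≤ y + s • k) (hk : ∃ o, 0 < k o) :
    ∃! o, 0 < k o ∧ ∃ s : ℝ, 0 ≤ y + s • k ∧ (y + s • k) o = 0 := by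
  obtain ⟨o₀, ho₀⟩ := hk
  obtain ⟨s₁, hs₁⟩ := hne
  -- As s decreases, the first constraint to become active is the one with the largest root -y o / k
  -- o.
  obtain ⟨o, ho, hmax⟩ := Finset.exists_max_image (Finset.univ.filter fun o => 0 < k o)
    (fun o => -y o / k o) ⟨o₀, by simpa using ho₀⟩
  have hko : 0 < k o := by simpa using ho
  have key : ∀ (s t : ℝ) (o₁ : σ), 0 ≤ y + s • k → 0 < k o₁ → (y + t • k) o₁ = 0 → t ≤ s := by
    intro s t o₁ hs hk₁ ht
    have h1 := hs o₁
    simp only [Pi.zero_apply, Pi.add_apply, Pi.smul_apply, smul_eq_mul] at h1 ht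
    exact le_of_mul_le_mul_right (by linarith) hk₁
  have hzero : (y + (-y o / k o) • k) o = 0 := by
    simp [div_mul_cancel₀ _ hko.ne']
  have hle : -y o / k o ≤ s₁ := key _ _ o hs₁ hko hzero
  have hfeas : 0 ≤ y + (-y o / k o) • k := by
    intro o₁
    have h1 := hs₁ o₁
    simp only [Pi.zero_apply, Pi.add_apply, Pi.smul_apply, smul_eq_mul] at h1 ⊢
    rcases lt_or_ge 0 (k o₁) with h | h
    · have := (div_le_iff₀ h).1 (hmax o₁ (by simpa using h))
      linarith
    · have := mul_le_mul_of_nonpos_right hle h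
      linarith
  refine ⟨o, ⟨hko, _, hfeas, hzero⟩, ?_⟩
  rintro o₁ ⟨hk₁, s, hs, hs0⟩
  have hst : s = -y o / k o :=
    le_antisymm (key _ _ o₁ hfeas hk₁ hs0) (key _ _ o hs hko hzero)
  subst hst
  exact hgen _ hs _ _ hs0 hzero

/-- If k o = 0, coordinate o vanishes on the whole line, so the end point in direction -k would have
two zero coordinates. -/
theorem direction_ne_zero_of_active {y k : σ → ℝ}
    (hgen : ∀ s : ℝ, 0 ≤ y + s • k → ∀ o o', (y + s • k) o = 0 → (y + s • k) o' = 0 → o = o')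
    (hk : ∃ o, 0 < k o) {o : σ} {s : ℝ} (hs : 0 ≤ y + s • k) (h0 : (y + s • k) o = 0) :
    k o ≠ 0 := by
  intro hko
  obtain ⟨o', ⟨hko', t, ht, ht0⟩, -⟩ := existsUnique_active_of_pos hgen ⟨s, hs⟩ hk
  have : (y + t • k) o = 0 := by
    simp only [Pi.add_apply, Pi.smul_apply, hko, smul_zero] at h0 ⊢
    exact h0
  obtain rfl := hgen t ht _ _ this ht0
  exact hko'.ne' hko

/-- A generic bounded segment in the orthant has no or two end points. -/
theorem even_card_active {y k : σ → ℝ}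
    (hgen : ∀ s : ℝ, 0 ≤ y + s • k → ∀ o o', (y + s • k) o = 0 → (y + s • k) o' = 0 → o = o')
    (hpos : ∃ o, 0 < k o) (hneg : ∃ o, k o < 0)
    [DecidablePred fun o => ∃ s : ℝ, 0 ≤ y + s • k ∧ (y + s • k) o = 0] :
    Even (Finset.univ.filter fun o => ∃ s : ℝ, 0 ≤ y + s • k ∧ (y + s • k) o = 0).card := by
  classical
  by_cases hne : ∃ s : ℝ, 0 ≤ y + s • k
  · obtain ⟨o₁, ⟨hk₁, s₁, hs₁, h₁⟩, hu₁⟩ := existsUnique_active_of_pos hgen hne hpos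
    have hflip : ∀ s : ℝ, y + s • (-k) = y + (-s) • k := fun s => by simp
    obtain ⟨o₂, ⟨hk₂, s₂, hs₂, h₂⟩, hu₂⟩ := existsUnique_active_of_pos (y := y) (k := -k)
      (fun s => by rw [hflip]; exact hgen (-s))
      (hne.imp' Neg.neg fun s hs => by rwa [hflip, neg_neg])
      (hneg.imp fun o ho => by simpa using ho)
    rw [hflip] at hs₂ h₂
    have hk₂' : k o₂ < 0 := by simpa using hk₂
    have hset : (Finset.univ.filter fun o => ∃ s : ℝ, 0 ≤ y + s • k ∧ (y + s • k) o = 0) =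
        {o₁, o₂} := by
      ext o
      simp only [Finset.mem_filter, Finset.mem_univ, true_and, Finset.mem_insert,
        Finset.mem_singleton]
      constructor
      · rintro ⟨s, hs, h0⟩
        rcases lt_or_gt_of_ne (direction_ne_zero_of_active hgen hpos hs h0) with h | h
        · exact Or.inr (hu₂ o ⟨by simpa using h, -s, by rwa [hflip, neg_neg],
            by rwa [hflip, neg_neg]⟩)
        · exact Or.inl (hu₁ o ⟨h, s, hs, h0⟩)
      · rintro (rfl | rfl)
        · exact ⟨s₁, hs₁, h₁⟩
        · exact ⟨-s₂, hs₂, h₂⟩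
    rw [hset, Finset.card_pair]
    · exact even_two
    · rintro rfl
      exact lt_asymm hk₁ hk₂'
  · rw [Finset.filter_false_of_mem]
    · simp
    · rintro o - ⟨s, hs, -⟩
      exact hne ⟨s, hs⟩

end Segment

/-! ### Lemke's theorem by counting end points modulo 2. -/

section AlmostComplementary

variable {ι : Type*} [Fintype ι] [DecidableEq ι]

/-- The complementary columns of `complMap` augmented by the covering column `-1`. -/
def almostComplMap (N : Matrix ι ι ℝ) (α : Finset ι) : (Option ι → ℝ) →ₗ[ℝ] (ι → ℝ) :=
  complMap N α ∘ₗ LinearMap.funLeft ℝ ℝ some - (LinearMap.proj none).smulRight 1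

theorem almostComplMap_apply (N : Matrix ι ι ℝ) (α : Finset ι) (y : Option ι → ℝ) :
    almostComplMap N α y = complMap N α (fun i => y (some i)) - y none • 1 := rfl

theorem complMap_symmDiff_singleton (N : Matrix ι ι ℝ) (α : Finset ι) (i : ι) {x : ι → ℝ}
    (hx : x i = 0) : complMap N (symmDiff α {i}) x = complMap N α x := by
  have h : ∀ j, x j = 0 ∨ (j ∈ symmDiff α {i} ↔ j ∈ α) := by
    intro j
    by_cases hj : j = i
    · exact Or.inl (hj ▸ hx)
    · exact Or.inr (by simp [Finset.mem_symmDiff, hj])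
  have h1 : (fun j => if j ∈ symmDiff α {i} then x j else 0) = fun j => if j ∈ α then x j else 0 := by
    ext j
    rcases h j with hj | hj <;> simp [hj]
  have h2 : (fun j => if j ∈ symmDiff α {i} then 0 else x j) = fun j => if j ∈ α then 0 else x j := by
    ext j
    rcases h j with hj | hj <;> simp [hj]
  rw [complMap_apply, complMap_apply, h1, h2]

/-- For strictly copositive `N` and `p ≥ 0`, zero is the only solution of `LCP(N, p)`. -/
theorem eq_zero_of_complMap_nonneg {N : Matrix ι ι ℝ}
    (hN : ∀ z : ι → ℝ, 0 ≤ z → z ≠ 0 → 0 < z ⬝ᵥ (N *ᵥ z)) {α : Finset ι} {x : ι → ℝ} (hx : 0 ≤ x)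
    (hp : 0 ≤ complMap N α x) {i : ι} (hi : i ∈ α) : x i = 0 := by
  obtain ⟨h0, hz, -⟩ := restrict_mem_lcpSol hx rfl
  set z : ι → ℝ := fun i => if i ∈ α then x i else 0 with hzdef
  have hz0 : z = 0 := by
    by_contra hne
    have h1 := hN z hz hne
    have h2 : 0 ≤ z ⬝ᵥ complMap N α x := dotProduct_nonneg_of_nonneg hz hp
    rw [dotProduct_add] at h0
    linarith
  have := congrFun hz0 i
  simpa [hzdef, hi] using this

/-- A vector `q` in general position with respect to all almost complementary cones of `N`. -/
structure IsGenericFor (N : Matrix ι ι ℝ) (q : ι → ℝ) : Prop where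
  eq_of_apply_eq_zero : ∀ α y, almostComplMap N α y = q → ∀ o o', y o = 0 → y o' = 0 → o = o'
  surjective : ∀ α, q ∈ LinearMap.range (almostComplMap N α) →
    Function.Surjective (almostComplMap N α)

/-- The almost complementary cone of `α` has no unbounded edge unless `α = ∅`. -/
theorem not_nonneg_of_mem_ker {N : Matrix ι ι ℝ}
    (hN : ∀ z : ι → ℝ, 0 ≤ z → z ≠ 0 → 0 < z ⬝ᵥ (N *ᵥ z)) {q : ι → ℝ} (hq : IsGenericFor N q)
    {α : Finset ι} (hα : α.Nonempty) {y k : Option ι → ℝ} (hy : 0 ≤ y)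
    (hLy : almostComplMap N α y = q) (hk0 : k ≠ 0) (hLk : almostComplMap N α k = 0) :
    ¬ 0 ≤ k := by
  intro hk
  have hck : complMap N α (fun i => k (some i)) = k none • 1 := by
    rw [almostComplMap_apply, sub_eq_zero] at hLk
    exact hLk
  have hkα : ∀ i ∈ α, k (some i) = 0 := fun i hi =>
    eq_zero_of_complMap_nonneg hN (x := fun i => k (some i)) (fun i => hk (some i))
      (by rw [hck]; intro j; simpa using hk none) hi
  have hkn : 0 < k none := by
    refine lt_of_le_of_ne (hk none) fun h => hk0 ?_
    rw [← h, zero_smul, complMap_apply] at hck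
    have hz : (fun i => if i ∈ α then k (some i) else 0) = 0 := by
      ext i
      by_cases hi : i ∈ α <;> simp [hi, hkα]
    rw [hz, mulVec_zero, sub_zero] at hck
    ext o
    cases o with
    | none => exact h.symm
    | some i =>
      by_cases hi : i ∈ α
      · exact hkα i hi
      · simpa [hi] using congrFun hck i
  obtain ⟨i, hi⟩ := hα
  -- Far along k the shifted vector q + t·1 is nonnegative, so its LCP has only the zero solution.
  -- Coordinate i then vanishes while k does too, against genericity.
  obtain ⟨s, hs0, hs⟩ : ∃ s : ℝ, 0 ≤ s ∧ ∀ j, 0 ≤ q j + s * k none := by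
    refine ⟨(∑ j, |q j|) / k none, div_nonneg (Finset.sum_nonneg fun _ _ => abs_nonneg _) hkn.le,
      fun j => ?_⟩
    rw [div_mul_cancel₀ _ hkn.ne']
    have h1 : |q j| ≤ ∑ j, |q j| := Finset.single_le_sum (f := fun j => |q j|)
      (fun _ _ => abs_nonneg _) (Finset.mem_univ j)
    have h2 := neg_abs_le (q j)
    linarith
  have hline : ∀ t : ℝ, almostComplMap N α (y + t • k) = q := fun t => by
    rw [map_add, map_smul, hLy, hLk, smul_zero, add_zero]
  have hfeas : 0 ≤ y + s • k := add_nonneg hy (smul_nonneg hs0 hk)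
  have hyi : (y + s • k) (some i) = 0 := by
    refine eq_zero_of_complMap_nonneg hN (x := fun i => (y + s • k) (some i))
      (fun j => hfeas (some j)) ?_ hi
    have h1 : complMap N α (fun i => (y + s • k) (some i)) = q + (y + s • k) none • 1 := by
      rw [← hline s, almostComplMap_apply]; abel
    rw [h1]
    intro j
    have := hs j
    have := hy none
    simp only [Pi.zero_apply, Pi.add_apply, Pi.smul_apply, smul_eq_mul, Pi.one_apply, mul_one]
      at this ⊢
    linarith
  exact direction_ne_zero_of_active
    (fun t _ => hq.eq_of_apply_eq_zero α _ (hline t)) ⟨none, hkn⟩ hfeas hyi (hkα i hi)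

theorem exists_ker_generator {N : Matrix ι ι ℝ} {α : Finset ι}
    (h : Function.Surjective (almostComplMap N α)) :
    ∃ k, k ≠ 0 ∧ almostComplMap N α k = 0 ∧
      ∀ v, almostComplMap N α v = 0 → ∃ c : ℝ, c • k = v := by
  have h1 := (almostComplMap N α).finrank_range_add_finrank_ker
  rw [LinearMap.range_eq_top.2 h, finrank_top, Module.finrank_fintype_fun_eq_card,
    Module.finrank_fintype_fun_eq_card, Fintype.card_option] at h1
  have h2 : Module.finrank ℝ (LinearMap.ker (almostComplMap N α)) = 1 := by omega
  obtain ⟨⟨k, hk⟩, hk0, hgen⟩ := finrank_eq_one_iff'.1 h2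
  refine ⟨k, fun h => hk0 (Subtype.ext h), hk, fun v hv => ?_⟩
  obtain ⟨c, hc⟩ := hgen ⟨v, hv⟩
  exact ⟨c, congrArg Subtype.val hc⟩

/-- `o` indexes the missing column of a feasible basis inside the columns of
`almostComplMap N α`. -/
def IsFeasibleBasis (N : Matrix ι ι ℝ) (q : ι → ℝ) (α : Finset ι) (o : Option ι) : Prop :=
  ∃ y, 0 ≤ y ∧ almostComplMap N α y = q ∧ y o = 0

-- The fibre over q is a line whose directions k and -k both leave the orthant, so its feasible part
-- is empty or a bounded segment.
open Classical in
theorem even_card_isFeasibleBasis {N : Matrix ι ι ℝ}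
    (hN : ∀ z : ι → ℝ, 0 ≤ z → z ≠ 0 → 0 < z ⬝ᵥ (N *ᵥ z)) {q : ι → ℝ} (hq : IsGenericFor N q)
    {α : Finset ι} (hα : α.Nonempty) :
    Even (Finset.univ.filter fun o => IsFeasibleBasis N q α o).card := by
  by_cases hne : ∃ y, 0 ≤ y ∧ almostComplMap N α y = q
  · obtain ⟨y, hy, hLy⟩ := hne
    obtain ⟨k, hk0, hLk, hgen⟩ := exists_ker_generator (hq.surjective α ⟨y, hLy⟩)
    have hline : ∀ t : ℝ, almostComplMap N α (y + t • k) = q := fun t => by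
      rw [map_add, map_smul, hLy, hLk, smul_zero, add_zero]
    have hset : ∀ o, IsFeasibleBasis N q α o ↔ ∃ s : ℝ, 0 ≤ y + s • k ∧ (y + s • k) o = 0 := by
      intro o
      constructor
      · rintro ⟨y', hy', hLy', h0⟩
        obtain ⟨c, hc⟩ := hgen (y' - y) (by rw [map_sub, hLy, hLy', sub_self])
        have : y + c • k = y' := by rw [hc]; abel
        exact ⟨c, by rwa [this], by rwa [this]⟩
      · rintro ⟨s, hs, h0⟩
        exact ⟨_, hs, hline s, h0⟩
    have h1 := not_nonneg_of_mem_ker hN hq hα hy hLy hk0 hLk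
    have h2 := not_nonneg_of_mem_ker hN hq hα hy hLy (neg_ne_zero.2 hk0)
      (by rw [map_neg, hLk, neg_zero])
    simp only [Pi.le_def, not_forall, not_le, Pi.zero_apply, Pi.neg_apply, Left.neg_neg_iff]
      at h1 h2
    simp only [hset]
    exact even_card_active (fun t _ => hq.eq_of_apply_eq_zero α _ (hline t)) h2 h1
  · rw [Finset.filter_false_of_mem]
    · simp
    · rintro o - ⟨y, hy, hLy, -⟩
      exact hne ⟨y, hy, hLy⟩

-- Here the feasible fibre is a ray in the direction 1, with a single end point.
open Classical in
theorem card_isFeasibleBasis_empty {N : Matrix ι ι ℝ} {q : ι → ℝ} (hq : IsGenericFor N q) :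
    (Finset.univ.filter fun o => IsFeasibleBasis N q ∅ o).card = 1 := by
  have hL : ∀ y, almostComplMap N ∅ y = fun i => y (some i) - y none := by
    intro y
    have : (fun i : ι => if i ∈ (∅ : Finset ι) then y (some i) else 0) = 0 := by ext; simp
    rw [almostComplMap_apply, complMap_apply, this, mulVec_zero]
    ext i
    simp
  let y₀ : Option ι → ℝ := fun o => o.elim 0 q
  have hline : ∀ t : ℝ, almostComplMap N ∅ (y₀ + t • 1) = q := fun t => by
    rw [hL]; ext i; simp [y₀]
  have hset : ∀ o, IsFeasibleBasis N q ∅ o ↔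
      0 < (1 : Option ι → ℝ) o ∧ ∃ s : ℝ, 0 ≤ y₀ + s • 1 ∧ (y₀ + s • 1) o = 0 := by
    intro o
    constructor
    · rintro ⟨y, hy, hLy, h0⟩
      have : y₀ + (y none) • 1 = y := by
        ext o
        cases o with
        | none => simp [y₀]
        | some i => simp [y₀, ← hLy, hL]
      exact ⟨one_pos, y none, by rwa [this], by rwa [this]⟩
    · rintro ⟨-, s, hs, h0⟩
      exact ⟨_, hs, hline s, h0⟩
  have hne : ∃ s : ℝ, 0 ≤ y₀ + s • 1 := by
    refine ⟨∑ j, |q j|, fun o => ?_⟩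
    have hsum : 0 ≤ ∑ j, |q j| := Finset.sum_nonneg fun _ _ => abs_nonneg _
    cases o with
    | none => simpa [y₀] using hsum
    | some i =>
      have h1 := Finset.single_le_sum (f := fun j => |q j|) (fun _ _ => abs_nonneg _)
        (Finset.mem_univ i)
      have h2 := neg_abs_le (q i)
      simp only [Pi.zero_apply, Pi.add_apply, Pi.smul_apply, Pi.one_apply, smul_eq_mul, mul_one,
        y₀, Option.elim_some] at h1 ⊢
      linarith
  obtain ⟨o, ho, hu⟩ := existsUnique_active_of_pos (y := y₀) (k := 1)
    (fun t _ => hq.eq_of_apply_eq_zero ∅ _ (hline t)) hne ⟨none, one_pos⟩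
  rw [Finset.card_eq_one]
  refine ⟨o, ?_⟩
  ext o'
  simp only [Finset.mem_filter, Finset.mem_univ, true_and, Finset.mem_singleton, hset]
  exact ⟨hu o', fun h => h ▸ ho⟩

/-- Pivoting: the fibres of α and of α with i switched share the end points at which coordinate i
vanishes. -/
theorem isFeasibleBasis_symmDiff_iff (N : Matrix ι ι ℝ) (q : ι → ℝ) (α : Finset ι) (i : ι) :
    IsFeasibleBasis N q (symmDiff α {i}) (some i) ↔ IsFeasibleBasis N q α (some i) := by
  refine exists_congr fun y => and_congr_right fun _ => and_congr_left fun h0 => ?_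
  rw [almostComplMap_apply, almostComplMap_apply,
    complMap_symmDiff_singleton N α i (x := fun i => y (some i)) h0]

/-- Lemke's theorem by parity: the number of complementary cones containing a generic vector is
odd. -/
theorem lcpSol_nonempty_of_isGenericFor {N : Matrix ι ι ℝ}
    (hN : ∀ z : ι → ℝ, 0 ≤ z → z ≠ 0 → 0 < z ⬝ᵥ (N *ᵥ z)) {q : ι → ℝ} (hq : IsGenericFor N q) :
    (lcpSol N q).Nonempty := by
  classical
  let f : Finset ι → Option ι → ZMod 2 := fun α o => if IsFeasibleBasis N q α o then 1 else 0
  have hrow : ∀ α, ∑ o, f α o = ((Finset.univ.filter fun o => IsFeasibleBasis N q α o).card : ℕ) :=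
    fun α => by simp only [f, Finset.sum_boole]
  have htotal : ∑ α, ∑ o, f α o = 1 := by
    rw [Finset.sum_eq_single ∅]
    · rw [hrow, card_isFeasibleBasis_empty hq, Nat.cast_one]
    · intro α _ hα
      rw [hrow, ZMod.natCast_eq_zero_iff_even]
      exact even_card_isFeasibleBasis hN hq (Finset.nonempty_iff_ne_empty.2 hα)
    · simp
  -- Switching i is a fixed-point-free involution, so these end points cancel in pairs; the odd
  -- total must come from `none`, where the covering variable is zero.
  have hcol : ∀ i, ∑ α, f α (some i) = 0 := by
    intro i
    have hf : ∀ α, f (symmDiff α {i}) (some i) = f α (some i) := fun α => by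
      simp only [f, isFeasibleBasis_symmDiff_iff]
    refine Finset.sum_involution (fun α _ => symmDiff α {i}) (fun α _ => ?_) (fun α _ _ h => ?_)
      (fun _ _ => Finset.mem_univ _) (fun α _ => ?_)
    · rw [hf]
      exact CharTwo.add_self_eq_zero _
    · have := symmDiff_eq_left.1 h
      simp at this
    · rw [symmDiff_assoc, symmDiff_self, symmDiff_bot]
  rw [Finset.sum_comm, Fintype.sum_option, Finset.sum_eq_zero fun i _ => hcol i, add_zero] at htotal
  obtain ⟨α, -, hα⟩ := Finset.exists_ne_zero_of_sum_ne_zero (htotal ▸ one_ne_zero)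
  have hb : IsFeasibleBasis N q α none := by
    by_contra h
    exact hα (if_neg h)
  obtain ⟨y, hy, hLy, h0⟩ := hb
  rw [almostComplMap_apply, h0, zero_smul, sub_zero] at hLy
  exact ⟨_, restrict_mem_lcpSol (fun i => hy (some i)) hLy⟩

end AlmostComplementary

/-! ### Existence by regularization and generic perturbation. -/

section Existence

variable {ι : Type*} [Fintype ι] [DecidableEq ι]

theorem finrank_ker_proj_prod_proj {o o' : Option ι} (h : o ≠ o') :
    Module.finrank ℝ (LinearMap.ker ((LinearMap.proj o).prod (LinearMap.proj o') :
      (Option ι → ℝ) →ₗ[ℝ] ℝ × ℝ)) < Fintype.card ι := by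
  have hsurj : Function.Surjective ((LinearMap.proj o).prod (LinearMap.proj o') :
      (Option ι → ℝ) →ₗ[ℝ] ℝ × ℝ) := by
    rintro ⟨a, b⟩
    refine ⟨Pi.single o a + Pi.single o' b, ?_⟩
    simp [h, h.symm]
  have h1 := ((LinearMap.proj o).prod (LinearMap.proj o') :
      (Option ι → ℝ) →ₗ[ℝ] ℝ × ℝ).finrank_range_add_finrank_ker
  rw [LinearMap.range_eq_top.2 hsurj, finrank_top, Module.finrank_prod, Module.finrank_self,
    Module.finrank_fintype_fun_eq_card, Fintype.card_option] at h1
  omega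

/-- The bad vectors lie in finitely many proper subspaces, a Lebesgue-null set. -/
theorem dense_isGenericFor (N : Matrix ι ι ℝ) : Dense {q | IsGenericFor N q} := by
  have hnull : ∀ W : Submodule ℝ (ι → ℝ), W ≠ ⊤ →
      ∀ᵐ q ∂(MeasureTheory.volume : MeasureTheory.Measure (ι → ℝ)), q ∉ W := fun W hW =>
    MeasureTheory.measure_eq_zero_iff_ae_notMem.1 (MeasureTheory.Measure.addHaar_submodule _ W hW)
  have h1 : ∀ᵐ q ∂(MeasureTheory.volume : MeasureTheory.Measure (ι → ℝ)),
      ∀ (α : Finset ι) (o o' : Option ι), o ≠ o' →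
        q ∉ (LinearMap.ker ((LinearMap.proj o).prod (LinearMap.proj o') :
          (Option ι → ℝ) →ₗ[ℝ] ℝ × ℝ)).map (almostComplMap N α) := by
    simp only [MeasureTheory.ae_all_iff]
    intro α o o' h
    refine hnull _ fun htop => ?_
    have h2 := (Submodule.finrank_map_le (almostComplMap N α) _).trans_lt
      (finrank_ker_proj_prod_proj h)
    rw [htop, finrank_top, Module.finrank_fintype_fun_eq_card] at h2
    exact lt_irrefl _ h2
  have h2 : ∀ᵐ q ∂(MeasureTheory.volume : MeasureTheory.Measure (ι → ℝ)),
      ∀ α : Finset ι, LinearMap.range (almostComplMap N α) ≠ ⊤ →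
        q ∉ LinearMap.range (almostComplMap N α) := by
    simp only [MeasureTheory.ae_all_iff]
    exact fun α h => hnull _ h
  refine MeasureTheory.Measure.dense_of_ae (μ := MeasureTheory.volume) ?_
  filter_upwards [h1, h2] with q hq1 hq2
  refine ⟨fun α y hy o o' ho ho' => ?_, fun α hα => ?_⟩
  · by_contra hne
    exact hq1 α o o' hne ⟨y, by simp [ho, ho'], hy⟩
  · rw [← LinearMap.range_eq_top]
    by_contra hne
    exact hq2 α hne hα

/-- Solvability of a regularized, generically perturbed copositive problem, with a bound on the
regularization term. -/
theorem exists_regularized_solution {M : Matrix ι ι ℝ}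
    (hM : ∀ z : ι → ℝ, 0 ≤ z → 0 ≤ z ⬝ᵥ (M *ᵥ z)) {q : ι → ℝ} {C : ℝ} (hC0 : 0 ≤ C)
    (hC : ∀ z : ι → ℝ, 0 ≤ z → (q ⬝ᵥ z) ^ 2 ≤ C * (z ⬝ᵥ (M *ᵥ z))) {ε : ℝ} (hε : 0 < ε) :
    ∃ q' z : ι → ℝ, (∀ i, |q' i - q i| ≤ ε ^ 2) ∧ z ∈ lcpSol M (q' + ε • z) ∧
      ∀ i, (ε * z i) ^ 2 ≤ ε * (C / 2 + Fintype.card ι * ε ^ 3) := by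
  have hMε : ∀ z : ι → ℝ, (M + ε • (1 : Matrix ι ι ℝ)) *ᵥ z = M *ᵥ z + ε • z := fun z => by
    rw [add_mulVec, smul_mulVec, one_mulVec]
  have hN : ∀ z : ι → ℝ, 0 ≤ z → z ≠ 0 → 0 < z ⬝ᵥ ((M + ε • (1 : Matrix ι ι ℝ)) *ᵥ z) := by
    intro z hz hz0
    rw [hMε, dotProduct_add, dotProduct_smul, smul_eq_mul]
    have h1 : 0 ≤ z ⬝ᵥ z := dotProduct_nonneg_of_nonneg hz hz
    have h2 : z ⬝ᵥ z ≠ 0 := fun h => hz0 (dotProduct_self_eq_zero.1 h)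
    have h3 := mul_pos hε (lt_of_le_of_ne h1 h2.symm)
    linarith [hM z hz]
  obtain ⟨q', hq', hdist⟩ := (dense_isGenericFor (M + ε • (1 : Matrix ι ι ℝ))).exists_dist_lt q
    (pow_pos hε 2)
  have hclose : ∀ i, |q' i - q i| ≤ ε ^ 2 := fun i => by
    rw [← Real.dist_eq, dist_comm]
    exact (dist_le_pi_dist q q' i).trans hdist.le
  obtain ⟨z, h0, hz, hw⟩ := lcpSol_nonempty_of_isGenericFor hN hq'
  have hshift : (M + ε • (1 : Matrix ι ι ℝ)) *ᵥ z + q' = M *ᵥ z + (q' + ε • z) := by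
    rw [hMε]; abel
  rw [hshift] at h0 hw
  refine ⟨q', z, hclose, ⟨h0, hz, hw⟩, fun i => ?_⟩
  -- Summing ε(zᵢ - ε)² ≥ 0 absorbs the ε² perturbation into half of the regularization term.
  have hpert : -(ε * (z ⬝ᵥ z) + Fintype.card ι * ε ^ 3) / 2 ≤ z ⬝ᵥ (q' - q) := by
    have : -(ε * (z ⬝ᵥ z) + Fintype.card ι * ε ^ 3) / 2 =
        ∑ i, -(ε * (z i * z i) + ε ^ 3) / 2 := by
      rw [← Finset.sum_div, Finset.sum_neg_distrib, Finset.sum_add_distrib, ← Finset.mul_sum]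
      simp [dotProduct]
    rw [this]
    refine Finset.sum_le_sum fun i _ => ?_
    have h1 := mul_le_mul_of_nonneg_left (abs_le.1 (hclose i)).1 (hz i)
    have h2 := mul_nonneg hε.le (sq_nonneg (z i - ε))
    simp only [Pi.sub_apply]
    linarith
  -- With a = zᵀMz ≥ 0, a + qᵀz ≥ a - √(Ca) ≥ -C/4.
  have hmain : -(C / 4) ≤ z ⬝ᵥ (M *ᵥ z) + q ⬝ᵥ z := by
    have h1 := hC z hz
    have h2 := hM z hz
    by_contra h
    nlinarith [sq_nonneg (z ⬝ᵥ (M *ᵥ z) - C / 4)]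
  have hsplit : z ⬝ᵥ (M *ᵥ z) + q ⬝ᵥ z + z ⬝ᵥ (q' - q) + ε * (z ⬝ᵥ z) = 0 := by
    rw [dotProduct_add, dotProduct_add, dotProduct_smul, smul_eq_mul] at h0
    rw [dotProduct_sub, dotProduct_comm q z]
    linarith
  have hzi : z i ^ 2 ≤ z ⬝ᵥ z := by
    rw [sq]
    exact Finset.single_le_sum (f := fun i => z i * z i) (fun _ _ => mul_self_nonneg _)
      (Finset.mem_univ i)
  have hS : ε * (z ⬝ᵥ z) ≤ C / 2 + Fintype.card ι * ε ^ 3 := by linarith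
  calc (ε * z i) ^ 2 = ε * (ε * z i ^ 2) := by ring
    _ ≤ ε * (ε * (z ⬝ᵥ z)) := by gcongr
    _ ≤ _ := by gcongr

/-- If `M` is copositive and `(qᵀ z)²` is dominated by `zᵀ M z` on the nonnegative orthant, then
`LCP(M, q)` is solvable. -/
theorem lcpSol_nonempty_of_copositive {M : Matrix ι ι ℝ}
    (hM : ∀ z : ι → ℝ, 0 ≤ z → 0 ≤ z ⬝ᵥ (M *ᵥ z)) {q : ι → ℝ} {C : ℝ} (hC0 : 0 ≤ C)
    (hC : ∀ z : ι → ℝ, 0 ≤ z → (q ⬝ᵥ z) ^ 2 ≤ C * (z ⬝ᵥ (M *ᵥ z))) :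
    (lcpSol M q).Nonempty := by
  refine (isClosed_setOf_lcpSol_nonempty M).closure_subset (Metric.mem_closure_iff.2 fun δ hδ => ?_)
  obtain ⟨ε, hε0, hεδ⟩ : ∃ ε : ℝ, 0 < ε ∧
      ε ^ 2 + √(ε * (C / 2 + Fintype.card ι * ε ^ 3)) < δ := by
    have hcont : Continuous fun ε : ℝ => ε ^ 2 + √(ε * (C / 2 + Fintype.card ι * ε ^ 3)) := by
      fun_prop
    have hlim := hcont.tendsto 0
    simp only [ne_eq, OfNat.ofNat_ne_zero, not_false_eq_true, zero_pow, zero_mul, Real.sqrt_zero,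
      add_zero] at hlim
    have h1 := (hlim.eventually (gt_mem_nhds hδ)).filter_mono
      (nhdsWithin_le_nhds (s := Set.Ioi 0))
    obtain ⟨ε, h, hε⟩ := (h1.and self_mem_nhdsWithin).exists
    exact ⟨ε, hε, h⟩
  obtain ⟨q', z, hq', hz, hbound⟩ := exists_regularized_solution hM hC0 hC hε0
  refine ⟨q' + ε • z, ⟨z, hz⟩, (dist_pi_lt_iff hδ).2 fun i => lt_of_le_of_lt ?_ hεδ⟩
  rw [dist_comm, Real.dist_eq]
  calc |(q' + ε • z) i - q i| = |(q' i - q i) + ε * z i| := by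
        simp only [Pi.add_apply, Pi.smul_apply, smul_eq_mul]; ring_nf
    _ ≤ |q' i - q i| + |ε * z i| := abs_add_le _ _
    _ ≤ _ := add_le_add (hq' i) (Real.abs_le_sqrt (hbound i))

end Existence

/-! ### The quadratic form of the contact problem. -/

/-- A linear form is dominated by a (not necessarily symmetric) positive definite quadratic form. -/
theorem exists_sq_dotProduct_le {n : Type*} [Fintype n] {B : Matrix n n ℝ}
    (hB : ∀ x : n → ℝ, x ≠ 0 → 0 < x ⬝ᵥ (B *ᵥ x)) (v : n → ℝ) :
    ∃ C : ℝ, 0 ≤ C ∧ ∀ u : n → ℝ, (v ⬝ᵥ u) ^ 2 ≤ C * (u ⬝ᵥ (B *ᵥ u)) := by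
  -- The quotient is homogeneous of degree 0, so a bound on the compact unit sphere is global.
  have hcont : ContinuousOn (fun x : n → ℝ => (v ⬝ᵥ x) ^ 2 / (x ⬝ᵥ (B *ᵥ x)))
      (Metric.sphere 0 1) := by
    refine ContinuousOn.div (by fun_prop) (by fun_prop) fun x hx => (hB x ?_).ne'
    exact ne_zero_of_mem_unit_sphere ⟨x, hx⟩
  obtain ⟨C, hC⟩ := (isCompact_sphere (0 : n → ℝ) 1).bddAbove_image hcont
  refine ⟨max 0 C, le_max_left _ _, fun u => ?_⟩
  by_cases hu : u = 0
  · simp [hu]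
  have hpos := hB u hu
  have hn : ‖u‖ ≠ 0 := norm_ne_zero_iff.2 hu
  have hmem : ‖u‖⁻¹ • u ∈ Metric.sphere (0 : n → ℝ) 1 := by
    simp [norm_smul, hn]
  have h1 := hC ⟨_, hmem, rfl⟩
  have h2 : (v ⬝ᵥ (‖u‖⁻¹ • u)) ^ 2 / ((‖u‖⁻¹ • u) ⬝ᵥ (B *ᵥ (‖u‖⁻¹ • u))) =
      (v ⬝ᵥ u) ^ 2 / (u ⬝ᵥ (B *ᵥ u)) := by
    rw [mulVec_smul, dotProduct_smul, dotProduct_smul, smul_dotProduct]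
    simp only [smul_eq_mul]
    field_simp
  simp only [h2] at h1
  exact (div_le_iff₀ hpos).1 (h1.trans (le_max_right _ _))

theorem dotProduct_mul_mul_transpose_mulVec {m n : Type*} [Fintype m] [Fintype n]
    (J : Matrix m n ℝ) (A : Matrix n n ℝ) (f : m → ℝ) :
    f ⬝ᵥ ((J * A * Jᵀ) *ᵥ f) = (Jᵀ *ᵥ f) ⬝ᵥ (A *ᵥ (Jᵀ *ᵥ f)) := by
  rw [← mulVec_mulVec, ← mulVec_mulVec, dotProduct_mulVec, ← mulVec_transpose]

/-- The quadratic form of the feedback LCP matrix: the friction blocks contribute only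
`sᵀ μ fₙ`. -/
theorem dotProduct_feedbackLcpMatrix_mulVec {nc nm : ℕ} (A : Matrix (Fin 3) (Fin 3) ℝ)
    (Jo : Matrix (ForceIdx nc) (Fin 3) ℝ) (Jm : Matrix (ForceIdx nc) (Fin nm) ℝ)
    (μ : Fin nc → ℝ) (K : Matrix (Fin nm) (Fin nm) ℝ)
    (fn : Fin nc → ℝ) (ft : Fin nc × Fin 2 → ℝ) (s : Fin nc → ℝ) :
    Sum.elim (Sum.elim fn ft) s ⬝ᵥ
        (feedbackLcpMatrix A Jo Jm μ K *ᵥ Sum.elim (Sum.elim fn ft) s) =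
      (Joᵀ *ᵥ Sum.elim fn ft) ⬝ᵥ (A *ᵥ (Joᵀ *ᵥ Sum.elim fn ft)) +
        (Jmᵀ *ᵥ Sum.elim fn ft) ⬝ᵥ (K *ᵥ (Jmᵀ *ᵥ Sum.elim fn ft)) +
        s ⬝ᵥ (diagonal μ *ᵥ fn) := by
  have hE : s ⬝ᵥ ((contactE nc)ᵀ *ᵥ ft) = ft ⬝ᵥ (contactE nc *ᵥ s) := by
    rw [mulVec_transpose, dotProduct_comm, ← dotProduct_mulVec]
  rw [feedbackLcpMatrix, fromBlocks_mulVec, Sum.elim_comp_inl, Sum.elim_comp_inr,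
    sumElim_dotProduct_sumElim, add_mulVec, dotProduct_add, dotProduct_add,
    dotProduct_mul_mul_transpose_mulVec, dotProduct_mul_mul_transpose_mulVec,
    fromRows_mulVec, sumElim_dotProduct_sumElim, fromCols_mulVec, Sum.elim_comp_inl,
    Sum.elim_comp_inr, zero_mulVec, dotProduct_zero, add_zero, zero_add, dotProduct_add,
    neg_mulVec, dotProduct_neg, hE]
  ring

theorem dotProduct_forceMotionMatrix_nonneg (G : Matrix (Fin 3) (Fin 3) ℝ)
    {Atilde : Matrix (Fin 3) (Fin 3) ℝ} (hA : Atilde.PosDef) (x : Fin 3 → ℝ) :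
    0 ≤ x ⬝ᵥ (forceMotionMatrix G Atilde *ᵥ x) := by
  rw [forceMotionMatrix, dotProduct_mul_mul_transpose_mulVec]
  exact hA.posSemidef.dotProduct_mulVec_nonneg _

theorem theorem1 (nc nm : ℕ)
    (Jno : Matrix (Fin nc) (Fin 3) ℝ) (Jto : Matrix (Fin nc × Fin 2) (Fin 3) ℝ)
    (Jnm : Matrix (Fin nc) (Fin nm) ℝ) (Jtm : Matrix (Fin nc × Fin 2) (Fin nm) ℝ)
    (μ : Fin nc → ℝ) (hμ : ∀ i, 0 ≤ μ i)
    (G Atilde : Matrix (Fin 3) (Fin 3) ℝ) (hG : G.det ≠ 0) (hA : Atilde.PosDef)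
    (c : ℝ) (B : Matrix (Fin nm) (Fin nm) ℝ) (vd : Fin nm → ℝ)
    (hc : 0 < c) (hB : ∀ x : Fin nm → ℝ, x ≠ 0 → 0 < x ⬝ᵥ (B *ᵥ x)) :
    (lcpSol
      (feedbackLcpMatrix (forceMotionMatrix G Atilde)
        (contactJacobian Jno Jto) (contactJacobian Jnm Jtm) μ (c • B))
      (feedbackLcpVector (contactJacobian Jnm Jtm) vd)).Nonempty := by
  have hcB : ∀ x : Fin nm → ℝ, x ≠ 0 → 0 < x ⬝ᵥ ((c • B) *ᵥ x) := fun x hx => by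
    rw [smul_mulVec, dotProduct_smul]
    exact mul_pos hc (hB x hx)
  have hcB' : ∀ x : Fin nm → ℝ, 0 ≤ x ⬝ᵥ ((c • B) *ᵥ x) := fun x => by
    by_cases hx : x = 0
    · simp [hx]
    · exact (hcB x hx).le
  obtain ⟨C, hC0, hC⟩ := exists_sq_dotProduct_le hcB vd
  generalize contactJacobian Jno Jto = Jo
  generalize contactJacobian Jnm Jtm = Jm
  -- Only the manipulator term is kept, since it alone controls qᵀz.
  have hform : ∀ z : LcpIdx nc → ℝ, 0 ≤ z →
      (Jmᵀ *ᵥ (z ∘ Sum.inl)) ⬝ᵥ ((c • B) *ᵥ (Jmᵀ *ᵥ (z ∘ Sum.inl))) ≤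
        z ⬝ᵥ (feedbackLcpMatrix (forceMotionMatrix G Atilde) Jo Jm μ (c • B) *ᵥ z) := by
    intro z hz
    have hf : Sum.elim (z ∘ Sum.inl ∘ Sum.inl) (z ∘ Sum.inl ∘ Sum.inr) = z ∘ Sum.inl := by
      ext (i | i) <;> rfl
    have hzelim : Sum.elim (z ∘ Sum.inl) (z ∘ Sum.inr) = z := Sum.elim_comp_inl_inr z
    have h1 := dotProduct_feedbackLcpMatrix_mulVec (forceMotionMatrix G Atilde) Jo Jm μ (c • B)
      (z ∘ Sum.inl ∘ Sum.inl) (z ∘ Sum.inl ∘ Sum.inr) (z ∘ Sum.inr)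
    rw [hf, hzelim] at h1
    have h2 := dotProduct_forceMotionMatrix_nonneg G hA (Joᵀ *ᵥ (z ∘ Sum.inl))
    have h3 : 0 ≤ (z ∘ Sum.inr) ⬝ᵥ (diagonal μ *ᵥ (z ∘ Sum.inl ∘ Sum.inl)) := by
      refine Finset.sum_nonneg fun i _ => mul_nonneg (hz _) ?_
      rw [mulVec_diagonal]
      exact mul_nonneg (hμ i) (hz _)
    linarith
  refine lcpSol_nonempty_of_copositive (fun z hz => (hcB' _).trans (hform z hz)) hC0
    fun z hz => ?_
  have hq : feedbackLcpVector Jm vd ⬝ᵥ z = vd ⬝ᵥ (Jmᵀ *ᵥ (z ∘ Sum.inl)) := by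
    rw [← Sum.elim_comp_inl_inr z, feedbackLcpVector, sumElim_dotProduct_sumElim, zero_dotProduct,
      add_zero, Sum.elim_comp_inl, mulVec_transpose, dotProduct_comm vd, ← dotProduct_mulVec,
      dotProduct_comm]
  rw [hq]
  exact (hC _).trans (mul_le_mul_of_nonneg_left (hform z hz) hC0)
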